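/- For a finite group $G$, let $o(g)$ denote the order of $g\in G$ and put $\rho(G)=\prod_{g\in G}o(g)$. If $\rho(G)=p_1^{\alpha_1}\cdots p_k^{\alpha_k}$ with $p_1,\dots,p_k$ distinct primes and all $\alpha_i\ge 1$, let $\operatorname{Exp}_\rho(G)=\{\alpha_1,\dots,\alpha_k\}$, regarded as a set (without multiplicities). Then $$\operatorname{Exp}_\rho(\mathrm{PSL}(2,7))=\{48,56,105\},$$ and a finite group $G$ satisfies $G\cong\mathrm{PSL}(2,7)$ if and only if $\operatorname{Exp}_\rho(G)=\operatorname{Exp}_\rho(\mathrm{PSL}(2,7))$. -/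

import Mathlib

/-- `ρ(G)`, the product of the orders of all elements of the finite group `G`. -/
noncomputable def rho (G : Type*) [Group G] [Finite G] : ℕ :=
  ∏ᶠ g : G, orderOf g

/-- `Exp(n)`, the set of the exponents in the prime factorization of `n`: the exponents of the
primes that divide `n`, so that `0` is never a member. -/
def expSet (n : ℕ) : Set ℕ :=
  {a | ∃ p : ℕ, p.Prime ∧ p ∣ n ∧ n.factorization p = a}

/-- `Exp_ρ(G) = Exp(ρ(G))`. -/
def expRho (G : Type*) [Group G] [Finite G] : Set ℕ :=
  expSet (rho G)

/-- `PSL(2, 7) = SL(2, 𝔽₇) / Z(SL(2, 𝔽₇))`. -/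
abbrev PSL27 : Type :=
  Matrix.ProjectiveSpecialLinearGroup (Fin 2) (ZMod 7)

-- The key fact is that the `p'`-part of `|G|` divides the exponent of `p` in `ρ(G)`
-- (`ordCompl_dvd_factorization_rho`). For a prime `q ≠ p`, replacing `g` by its `q`-regular part
-- `y` keeps the `p`-part of its order. The elements with `q`-regular part `y` correspond to the
-- `q`-elements of `C(y)`, whose number is divisible by `|C(y)|_q` by Frobenius' theorem, so each
-- conjugacy class of `y` contributes a multiple of `|G|_q`.
--
-- If the exponents are 48, 56 and 105, this forces the primes 7, 3, 2 respectively and `|G|` to be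
-- 84 or 168, with 48 elements of order divisible by 7 and 56 of order divisible by 3. These counts
-- give eight Sylow 7-subgroups and `|G| = 168`. Labelling them by the projective line over `𝔽₇`,
-- suitable elements of `G` act as `i + 1`, `2i` and `-1/i`, so `G` is isomorphic to `lineGroup`
-- (`nonempty_mulEquiv_lineGroup`).
--
-- In `PSL(2,7)` the order of a nontrivial element depends only on the trace of a lift, so `ρ` is a
-- finite computation. As `PSL(2,7)` then satisfies the same hypothesis, it too is isomorphic to
-- `lineGroup`.

universe u

/-! ### Frobenius' theorem and sums of class functions over regular parts. -/

open Finset in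
theorem dvd_sum_of_conj_invariant {G : Type u} [Group G] [Fintype G] (f : G → ℕ)
    (hf : ∀ g h, f (h * g * h⁻¹) = f g) (d : ℕ)
    (hd : ∀ g, d ∣ (Subgroup.centralizer {g}).index * f g) : d ∣ ∑ g, f g := by
  classical
  rw [← Finset.sum_fiberwise (s := univ) (g := fun g : G => ConjClasses.mk g)]
  refine Finset.dvd_sum fun c _ => ?_
  obtain ⟨g, rfl⟩ := ConjClasses.exists_rep c
  have hcongr : ∀ x ∈ univ.filter (fun x : G => ConjClasses.mk x = ConjClasses.mk g), f x = f g := by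
    intro x hx
    rw [mem_filter, ConjClasses.mk_eq_mk_iff_isConj, isConj_comm, isConj_iff] at hx
    obtain ⟨c, hc⟩ := hx.2
    rw [← hc, hf]
  rw [Finset.sum_congr rfl hcongr, Finset.sum_const, smul_eq_mul]
  have h := MulAction.index_stabilizer (ConjAct G) g
  rw [ConjAct.stabilizer_eq_centralizer, ConjAct.orbit_eq_carrier_conjClasses] at h
  have h2 : (univ.filter fun x : G => ConjClasses.mk x = ConjClasses.mk g).card =
      (Subgroup.centralizer {g}).index := by
    refine Eq.trans ?_ h.symm
    rw [← Set.ncard_coe_finset]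
    congr 1
    ext x
    simp [ConjClasses.mem_carrier_iff_mk_eq]
  rw [h2]
  exact hd g

theorem card_pow_eq_conj {G : Type u} [Group G] (m : ℕ) (y h : G) :
    Nat.card {g : G // g ^ m = h * y * h⁻¹} = Nat.card {g : G // g ^ m = y} := by
  refine (Nat.card_congr ((MulAut.conj h).toEquiv.subtypeEquiv fun g => ?_)).symm
  simp [conj_pow]

/-- If `y ^ m = y`, then dividing by `y` identifies the solutions of `g ^ m = y` with the
solutions of `u ^ m = 1` in the centralizer of `y`. -/
theorem card_pow_eq_of_pow_eq {G : Type u} [Group G] {m : ℕ} {y : G} (hy : y ^ m = y) :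
    Nat.card {g : G // g ^ m = y} =
      Nat.card {u : Subgroup.centralizer {y} // u ^ m = 1} := by
  refine Nat.card_congr ⟨fun g => ⟨⟨g.1 * y⁻¹, ?_⟩, ?_⟩, fun u => ⟨u.1.1 * y, ?_⟩, ?_, ?_⟩
  · rw [Subgroup.mem_centralizer_singleton_iff]
    have h : Commute g.1 y := by
      nth_rw 2 [← g.2]; exact Commute.self_pow _ _
    simpa using ((h.mul_left (Commute.refl y).inv_left)).eq
  · have h : Commute g.1 y⁻¹ := by
      rw [Commute.inv_right_iff]; nth_rw 2 [← g.2]; exact Commute.self_pow _ _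
    ext
    simp [h.mul_pow, g.2, hy]
  · have h : Commute u.1.1 y := (Subgroup.mem_centralizer_singleton_iff.1 u.1.2)
    have h2 : u.1.1 ^ m = 1 := by simpa using congrArg Subtype.val u.2
    rw [h.mul_pow, h2, hy, one_mul]
  · intro g; simp
  · intro g; simp

theorem pow_mul_self_eq {G : Type u} [Group G] [Finite G] {q a r m : ℕ} (hq : q.Prime)
    (hr : ¬ q ∣ r) (hm : q ^ a ∣ m) (hm1 : m ≡ 1 [MOD r]) (hG : Nat.card G ∣ q ^ a * r) (g : G) :
    (g ^ m) ^ m = g ^ m := by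
  rw [← pow_mul, pow_eq_pow_iff_modEq]
  refine Nat.ModEq.of_dvd ((orderOf_dvd_natCard g).trans hG) ?_
  rw [← Nat.modEq_and_modEq_iff_modEq_mul
    (Nat.Coprime.pow_left a ((Nat.Prime.coprime_iff_not_dvd hq).2 hr))]
  constructor
  · exact ((Nat.modEq_zero_iff_dvd.2 (hm.mul_left m)).trans (Nat.modEq_zero_iff_dvd.2 hm).symm)
  · simpa using hm1.mul_left m

theorem pow_factorization_dvd_mul {q x y s t : ℕ} (hx : x ≠ 0) (hy : y ≠ 0)
    (h1 : q ^ (x.factorization q) ∣ s) (h2 : q ^ (y.factorization q) ∣ t) :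
    q ^ ((x * y).factorization q) ∣ s * t := by
  rw [Nat.factorization_mul hx hy, Finsupp.add_apply, pow_add]
  exact mul_dvd_mul h1 h2

/-- Frobenius' theorem on the number of `q`-elements: if raising to the power `m` extracts the
`q`-regular part, the solutions of `u ^ m = 1` are the `q`-elements. -/
theorem pow_factorization_dvd_card_pow_eq_one {q a r m : ℕ} (hq : q.Prime)
    (hr : ¬ q ∣ r) (hm : q ^ a ∣ m) (hm1 : m ≡ 1 [MOD r]) (n : ℕ) :
    ∀ (G : Type u) [Group G] [Finite G], Nat.card G = n → n ∣ q ^ a * r →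
      q ^ (n.factorization q) ∣ Nat.card {u : G // u ^ m = 1} := by
  induction n using Nat.strong_induction_on with
  | _ n ih =>
  intro G _ _ hn hdvd
  classical
  have := Fintype.ofFinite G
  have hidem := pow_mul_self_eq (G := G) hq hr hm hm1 (hn ▸ hdvd)
  let F : G → ℕ := fun y => Nat.card {g : G // g ^ m = y}
  have hcard : n = ∑ y, F y := by
    rw [← hn, Nat.card_eq_fintype_card, ← Finset.card_univ,
      Finset.card_eq_sum_card_fiberwise (f := fun g : G => g ^ m) (t := Finset.univ) (by simp)]
    refine Finset.sum_congr rfl fun y _ => ?_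
    simp [F, Fintype.card_subtype]
  -- For noncentral `y` the centralizer is smaller, so induction gives its `q`-part as a divisor of
  -- `F y`; the class size supplies the rest.
  have hnc : q ^ (n.factorization q) ∣ ∑ y, if y ∈ Subgroup.center G then 0 else F y := by
    refine dvd_sum_of_conj_invariant _ ?_ _ ?_
    · intro g h
      have : h * g * h⁻¹ ∈ Subgroup.center G ↔ g ∈ Subgroup.center G := by
        refine ⟨fun H => ?_, fun H => Subgroup.Normal.conj_mem inferInstance g H h⟩
        have := Subgroup.Normal.conj_mem (inferInstance : (Subgroup.center G).Normal) _ H h⁻¹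
        simpa [mul_assoc] using this
      simp only [this, F, card_pow_eq_conj]
    · intro y
      split_ifs with hy
      · simp
      by_cases hym : y ^ m = y
      · have hidx := (Subgroup.centralizer {y}).index_mul_card
        have hlt : Nat.card (Subgroup.centralizer {y}) < n := by
          rw [← hn]
          refine lt_of_le_of_ne (Nat.card_le_card_of_injective _ Subtype.val_injective) fun h => hy ?_
          have := Subgroup.eq_top_of_card_eq _ h
          rw [Subgroup.centralizer_eq_top_iff_subset] at this
          simpa using this
        have hd : Nat.card (Subgroup.centralizer {y}) ∣ n := hn ▸ Subgroup.card_subgroup_dvd_card _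
        have := ih _ hlt (Subgroup.centralizer {y}) rfl (hd.trans hdvd)
        rw [← hn, ← hidx]
        refine pow_factorization_dvd_mul Subgroup.index_ne_zero_of_finite Nat.card_pos.ne'
          (Nat.ordProj_dvd _ _) ?_
        simpa only [F, card_pow_eq_of_pow_eq hym] using this
      · have : F y = 0 := by
          have : IsEmpty {g : G // g ^ m = y} := ⟨fun g => hym (by rw [← g.2, hidem])⟩
          simp [F]
        simp [this]
  let H : Subgroup (Subgroup.center G) := 
    { carrier := {y | y ^ m = y}
      mul_mem' := fun {y z} (hy : y ^ m = y) (hz : z ^ m = z) =>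
        show (y * z) ^ m = y * z by
          rw [(show Commute y z from Subtype.ext (y.2.comm z)).mul_pow, hy, hz]
      one_mem' := one_pow m
      inv_mem' := fun {y} (hy : y ^ m = y) => show y⁻¹ ^ m = y⁻¹ by rw [inv_pow, hy] }
  -- A central `y` in `H` has centralizer `G`, so its fibre is as large as that of `1`; other
  -- central fibres are empty.
  have hc : ∑ y, (if y ∈ Subgroup.center G then F y else 0) = Nat.card H * F 1 := by
    have h1 : ∀ y, (if y ∈ Subgroup.center G then F y else 0) =
        if y ∈ Subgroup.center G ∧ y ^ m = y then F 1 else 0 := by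
      intro y
      by_cases hy : y ∈ Subgroup.center G
      · by_cases hym : y ^ m = y
        · simp only [hy, hym, F, if_true, and_self]
          rw [card_pow_eq_of_pow_eq hym]
          have htop : Subgroup.centralizer {y} = ⊤ := by
            rw [Subgroup.centralizer_eq_top_iff_subset]; simpa using hy
          rw [htop]
          refine Nat.card_congr (Subgroup.topEquiv.toEquiv.subtypeEquiv fun u => ?_)
          simp [Subtype.ext_iff]
        · have : F y = 0 := by
            have : IsEmpty {g : G // g ^ m = y} := ⟨fun g => hym (by rw [← g.2, hidem])⟩
            simp [F]
          simp [this, hym]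
      · simp [hy]
    rw [Finset.sum_congr rfl fun y _ => h1 y, ← Finset.sum_filter, Finset.sum_const, smul_eq_mul]
    congr 1
    rw [← Fintype.card_subtype, ← Nat.card_eq_fintype_card]
    refine Nat.card_congr ⟨fun y => ⟨⟨y.1, y.2.1⟩, ?_⟩, fun y => ⟨y.1.1, y.1.2, ?_⟩, ?_, ?_⟩
    · exact Subtype.ext y.2.2
    · exact congrArg Subtype.val y.2
    · intro y; rfl
    · intro y; rfl
  -- An element of order `q` in `H` would satisfy both `y ^ m = y` and, since `q ∣ m`, `y ^ m = 1`.
  have hcop : ¬ q ∣ Nat.card H := by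
    intro hqH
    have := Fact.mk hq
    obtain ⟨y, hy⟩ := exists_prime_orderOf_dvd_card' q hqH
    have hqm : q ∣ m := by
      have hqn : q ∣ n := hn ▸ hqH.trans ((Subgroup.card_subgroup_dvd_card H).trans
        (Subgroup.card_subgroup_dvd_card _))
      rcases Nat.eq_zero_or_pos a with rfl | ha
      · rw [pow_zero, one_mul] at hdvd
        exact absurd (hqn.trans hdvd) hr
      · exact (dvd_pow_self q ha.ne').trans hm
    have h1 : y.1 ^ m = y.1 := y.2
    have h2 : y ^ m = 1 := orderOf_dvd_iff_pow_eq_one.1 (hy ▸ hqm)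
    have h3 : y = 1 := by
      rw [← h2]; exact Subtype.ext h1.symm
    rw [h3, orderOf_one] at hy
    exact hq.one_lt.ne hy
  have hsum : n = (∑ y, if y ∈ Subgroup.center G then F y else 0) +
      ∑ y, if y ∈ Subgroup.center G then 0 else F y := by
    rw [← Finset.sum_add_distrib, hcard]
    exact Finset.sum_congr rfl fun y _ => by split_ifs <;> simp
  have hd2 : q ^ (n.factorization q) ∣ Nat.card H * F 1 := by
    rw [← hc]
    refine (Nat.dvd_add_left hnc).1 ?_
    rw [← hsum]
    exact Nat.ordProj_dvd _ _
  exact Nat.Coprime.dvd_of_dvd_mul_left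
    (Nat.Coprime.pow_left _ ((Nat.Prime.coprime_iff_not_dvd hq).2 hcop)) hd2

theorem pow_factorization_dvd_sum_pow {q a r m : ℕ} (hq : q.Prime)
    (hr : ¬ q ∣ r) (hm : q ^ a ∣ m) (hm1 : m ≡ 1 [MOD r])
    {G : Type u} [Group G] [Fintype G] (hG : Nat.card G ∣ q ^ a * r) (w : G → ℕ)
    (hw : ∀ g h, w (h * g * h⁻¹) = w g) :
    q ^ ((Nat.card G).factorization q) ∣ ∑ g, w (g ^ m) := by
  classical
  have hidem := pow_mul_self_eq (G := G) hq hr hm hm1 hG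
  have h : ∑ g, w (g ^ m) = ∑ y, w y * Nat.card {g : G // g ^ m = y} := by
    rw [← Finset.sum_fiberwise (s := Finset.univ) (g := fun g : G => g ^ m)]
    refine Finset.sum_congr rfl fun y _ => ?_
    rw [Finset.sum_congr rfl (g := fun _ => w y) (by
      intro x hx; rw [(Finset.mem_filter.1 hx).2]), Finset.sum_const, smul_eq_mul, mul_comm,
      Nat.card_eq_fintype_card, Fintype.card_subtype]
  rw [h]
  refine dvd_sum_of_conj_invariant _ (fun g h => by rw [hw, card_pow_eq_conj]) _ fun y => ?_
  by_cases hym : y ^ m = y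
  · have := pow_factorization_dvd_card_pow_eq_one hq hr hm hm1 _ (Subgroup.centralizer {y}) rfl
      ((Subgroup.card_subgroup_dvd_card _).trans hG)
    rw [mul_left_comm, card_pow_eq_of_pow_eq hym]
    refine Dvd.dvd.mul_left ?_ _
    rw [← (Subgroup.centralizer {y}).index_mul_card]
    exact pow_factorization_dvd_mul Subgroup.index_ne_zero_of_finite Nat.card_pos.ne'
      (Nat.ordProj_dvd _ _) this
  · have : IsEmpty {g : G // g ^ m = y} := ⟨fun g => hym (by rw [← g.2, hidem])⟩
    simp

/-! ### Divisibility of the exponents of `ρ(G)`. -/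

theorem rho_eq_prod (G : Type u) [Group G] [Fintype G] : rho G = ∏ g : G, orderOf g :=
  finprod_eq_prod_of_fintype _

theorem factorization_rho (G : Type u) [Group G] [Fintype G] (p : ℕ) :
    (rho G).factorization p = ∑ g : G, (orderOf g).factorization p := by
  rw [rho_eq_prod, Nat.factorization_prod fun g _ => (orderOf_pos g).ne', Finset.sum_apply']

/-- The `p'`-part of `|G|` divides the exponent of `p` in `ρ(G)`. -/
theorem ordCompl_dvd_factorization_rho (G : Type u) [Group G] [Finite G] {p : ℕ} (hp : p.Prime) :
    ordCompl[p] (Nat.card G) ∣ (rho G).factorization p := by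
  have := Fintype.ofFinite G
  by_cases h0 : (rho G).factorization p = 0
  · simp [h0]
  have hn : Nat.card G ≠ 0 := Nat.card_pos.ne'
  rw [← Nat.factorization_le_iff_dvd (Nat.ordCompl_pos p hn).ne' h0]
  intro q
  by_cases hq : q.Prime
  swap
  · simp [Nat.factorization_eq_zero_of_not_prime _ hq]
  by_cases hqp : q = p
  · rw [hqp, Nat.factorization_ordCompl, Finsupp.erase_same]; exact Nat.zero_le _
  rw [Nat.factorization_ordCompl, Finsupp.erase_ne hqp,
    ← hq.pow_dvd_iff_le_factorization h0, factorization_rho]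
  have hr : ¬ q ∣ ordCompl[q] (Nat.card G) := Nat.not_dvd_ordCompl hq hn
  obtain ⟨m, hm0, hm1⟩ := Nat.chineseRemainder
    (Nat.Coprime.pow_left ((Nat.card G).factorization q) ((Nat.Prime.coprime_iff_not_dvd hq).2 hr))
    0 1
  rw [Nat.modEq_zero_iff_dvd] at hm0
  have key := pow_factorization_dvd_sum_pow hq hr hm0 hm1 (G := G)
    (by rw [Nat.ordProj_mul_ordCompl_eq_self]) (fun g => (orderOf g).factorization p)
    (fun g h => by
      have : orderOf (h * g * h⁻¹) = orderOf g :=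
        orderOf_injective (MulAut.conj h).toMonoidHom (MulAut.conj h).injective g
      rw [this])
  -- If `p` divides the order of `g`, then `p` divides the `q'`-part of `|G|`, so `m ≡ 1` modulo `p`
  -- and the `m`-th power keeps the `p`-part of the order.
  convert key using 2 with g
  by_cases hpg : p ∣ orderOf g
  · have hpr : p ∣ ordCompl[q] (Nat.card G) := by
      have h := hpg.trans (orderOf_dvd_natCard g)
      rw [← Nat.ordProj_mul_ordCompl_eq_self (Nat.card G) q] at h
      refine (hp.dvd_mul.1 h).resolve_left fun h => hqp ?_
      exact ((Nat.prime_dvd_prime_iff_eq hp hq).1 (hp.dvd_of_dvd_pow h)).symm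
    have hpm : ¬ p ∣ m := fun h => by
      have := (hm1.of_dvd hpr).symm.trans (Nat.modEq_zero_iff_dvd.2 h)
      exact hp.one_lt.ne' (Nat.dvd_one.1 (Nat.modEq_zero_iff_dvd.1 this))
    have hpgcd : ¬ p ∣ (orderOf g).gcd m := fun h => hpm (h.trans (Nat.gcd_dvd_right _ _))
    rw [orderOf_pow, Nat.factorization_div (Nat.gcd_dvd_left _ _), Finsupp.tsub_apply,
      Nat.factorization_eq_zero_of_not_dvd hpgcd, Nat.sub_zero]
  · rw [Nat.factorization_eq_zero_of_not_dvd hpg, Nat.factorization_eq_zero_of_not_dvd]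
    exact fun h => hpg (h.trans (orderOf_pow_dvd m))

theorem pow_dvd_ordCompl {n k p q : ℕ} (hp : p.Prime) (hq : q.Prime) (hqp : q ≠ p)
    (h : q ^ k ∣ n) : q ^ k ∣ ordCompl[p] n := by
  rw [← Nat.ordProj_mul_ordCompl_eq_self n p] at h
  exact (Nat.Coprime.pow _ _ ((Nat.coprime_primes hq hp).2 hqp)).dvd_of_dvd_mul_left h

theorem prime_dvd_rho_iff {G : Type u} [Group G] [Finite G] {p : ℕ} (hp : p.Prime) :
    p ∣ rho G ↔ p ∣ Nat.card G := by
  have := Fintype.ofFinite G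
  constructor
  · rw [rho_eq_prod, hp.prime.dvd_finsetProd_iff]
    rintro ⟨g, -, hg⟩
    exact hg.trans (orderOf_dvd_natCard g)
  · intro h
    have := Fact.mk hp
    obtain ⟨g, hg⟩ := exists_prime_orderOf_dvd_card' p h
    rw [rho_eq_prod]
    exact (hg ▸ dvd_rfl : p ∣ orderOf g).trans (Finset.dvd_prod_of_mem _ (Finset.mem_univ g))

/-- The number of elements of order divisible by `p`. -/
noncomputable def singularCount (G : Type u) [Group G] (p : ℕ) : ℕ :=
  Nat.card {g : G // p ∣ orderOf g}

theorem singularCount_eq_factorization_rho {G : Type u} [Group G] [Finite G] {p : ℕ}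
    (hp : p.Prime) (h : ¬ p ^ 2 ∣ Nat.card G) :
    singularCount G p = (rho G).factorization p := by
  classical
  have := Fintype.ofFinite G
  rw [factorization_rho, singularCount, Nat.card_eq_fintype_card, Fintype.card_subtype,
    Finset.card_filter]
  refine Finset.sum_congr rfl fun g _ => ?_
  have h0 := (orderOf_pos g).ne'
  split_ifs with hg
  · have h1 := (hp.dvd_iff_one_le_factorization h0).1 hg
    have h2 : ¬ 2 ≤ (orderOf g).factorization p := fun H => h
      (((hp.pow_dvd_iff_le_factorization h0).2 H).trans (orderOf_dvd_natCard g))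
    omega
  · rw [Nat.factorization_eq_zero_of_not_dvd hg]

/-! ### The order of `G` and its number of Sylow 7-subgroups. -/

/-- Each of the three primes divides the exponents of the other two. As `48 = 2⁴·3`, `56 = 2³·7` and
`105 = 3·5·7`, this assigns 7, 3, 2 to 48, 56, 105. The same divisibility excludes 49, 9 and 16 as
divisors of `|G|`, so for 7 and 3 the exponents count elements. -/
theorem card_and_singularCount_of_expRho {G : Type u} [Group G] [Finite G]
    (h : expRho G = {48, 56, 105}) :
    (Nat.card G = 84 ∨ Nat.card G = 168) ∧ singularCount G 7 = 48 ∧ singularCount G 3 = 56 := by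
  have h48 : 48 ∈ expRho G := by simp [h]
  have h56 : 56 ∈ expRho G := by simp [h]
  have h105 : 105 ∈ expRho G := by simp [h]
  obtain ⟨p, hp, hpd, hp48⟩ := h48
  obtain ⟨q, hq, hqd, hq56⟩ := h56
  obtain ⟨r, hr, hrd, hr105⟩ := h105
  have hpq : p ≠ q := by rintro rfl; omega
  have hpr : p ≠ r := by rintro rfl; omega
  have hqr : q ≠ r := by rintro rfl; omega
  rw [prime_dvd_rho_iff ‹_›] at hpd hqd hrd
  have dp := ordCompl_dvd_factorization_rho G hp
  have dq := ordCompl_dvd_factorization_rho G hq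
  have dr := ordCompl_dvd_factorization_rho G hr
  rw [hp48] at dp
  rw [hq56] at dq
  rw [hr105] at dr
  have key : ∀ {s t : ℕ} (k : ℕ), s.Prime → t.Prime → t ≠ s → t ^ k ∣ Nat.card G → ∀ {N : ℕ},
    ordCompl[s] (Nat.card G) ∣ N → t ^ k ∣ N := fun k hs ht hts h _ hN =>
      (pow_dvd_ordCompl hs ht hts h).trans hN
  have e48 : ∀ s : ℕ, s.Prime → s ∣ 48 → s = 2 ∨ s = 3 := fun s hs h => by
    have := hs.dvd_mul.1 (show s ∣ 2 ^ 4 * 3 from h)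
    refine this.imp (fun h => ?_) fun h => ?_
    · exact (Nat.prime_dvd_prime_iff_eq hs Nat.prime_two).1 (hs.dvd_of_dvd_pow h)
    · exact (Nat.prime_dvd_prime_iff_eq hs Nat.prime_three).1 h
  have e56 : ∀ s : ℕ, s.Prime → s ∣ 56 → s = 2 ∨ s = 7 := fun s hs h => by
    have := hs.dvd_mul.1 (show s ∣ 2 ^ 3 * 7 from h)
    refine this.imp (fun h => ?_) fun h => ?_
    · exact (Nat.prime_dvd_prime_iff_eq hs Nat.prime_two).1 (hs.dvd_of_dvd_pow h)
    · exact (Nat.prime_dvd_prime_iff_eq hs (by norm_num)).1 h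
  have q48 := e48 q hq (by simpa using key 1 hp hq hpq.symm (by simpa using hqd) dp)
  have r48 := e48 r hr (by simpa using key 1 hp hr hpr.symm (by simpa using hrd) dp)
  have p56 := e56 p hp (by simpa using key 1 hq hp hpq (by simpa using hpd) dq)
  have r56 := e56 r hr (by simpa using key 1 hq hr hqr.symm (by simpa using hrd) dq)
  obtain rfl : r = 2 := by omega
  obtain rfl : q = 3 := by omega
  obtain rfl : p = 7 := by omega
  have n49 : ¬ 7 ^ 2 ∣ Nat.card G := fun h => by
    have := key 2 hr hp (by norm_num) h dr
    norm_num at this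
  have n9 : ¬ 3 ^ 2 ∣ Nat.card G := fun h => by
    have := key 2 hr hq (by norm_num) h dr
    norm_num at this
  have n16 : ¬ 2 ^ 4 ∣ Nat.card G := fun h => by
    have := key 4 hq hr (by norm_num) h dq
    norm_num at this
  have h7 := singularCount_eq_factorization_rho hp n49
  have h3 := singularCount_eq_factorization_rho hq n9
  rw [hp48] at h7
  rw [hq56] at h3
  refine ⟨?_, h7, h3⟩
  have hle : singularCount G 3 ≤ Nat.card G :=
    Nat.card_le_card_of_injective _ Subtype.val_injective
  rw [h3] at hle
  have h0 : Nat.card G ≠ 0 := Nat.card_pos.ne'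
  have hv : (Nat.card G).factorization 7 = 1 := by
    have h1 := (hp.dvd_iff_one_le_factorization h0).1 hpd
    have h2 : ¬ 2 ≤ (Nat.card G).factorization 7 := fun H => n49
      ((hp.pow_dvd_iff_le_factorization h0).2 H)
    omega
  rw [hv, pow_one] at dp
  obtain ⟨k, hk⟩ := hpd
  rw [hk] at dp hle n16 hrd hqd ⊢
  rw [Nat.mul_div_cancel_left _ (by norm_num)] at dp
  -- Among the divisors of 48, only 12 and 24 are multiples of 6, not of 16, and satisfy `56 ≤ 7 *
  -- k`.
  have hk48 : k ∈ Nat.divisors 48 := Nat.mem_divisors.2 ⟨dp, by norm_num⟩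
  have : Nat.divisors 48 = {1, 2, 3, 4, 6, 8, 12, 16, 24, 48} := by decide +kernel
  rw [this] at hk48
  simp only [Finset.mem_insert, Finset.mem_singleton] at hk48
  omega

instance : Fact (Nat.Prime 7) := ⟨by norm_num⟩

/-- The exponent 120 is 0 modulo 24 and 1 modulo 7, so the 120th power is the 7-part of an element.
-/
theorem pow_eq_one_iff_not_seven_dvd {G : Type u} [Group G] [Finite G]
    (hG : Nat.card G ∣ 168) (g : G) : g ^ 120 = 1 ↔ ¬ 7 ∣ orderOf g := by
  rw [← orderOf_dvd_iff_pow_eq_one]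
  have h := (orderOf_dvd_natCard g).trans hG
  constructor
  · intro h1 h2
    have := h2.trans h1
    norm_num at this
  · intro h1
    have h2 : (orderOf g).Coprime 7 :=
      ((Nat.Prime.coprime_iff_not_dvd (by norm_num)).2 h1).symm
    exact (h2.dvd_of_dvd_mul_left (show orderOf g ∣ 7 * 24 from h)).trans (by norm_num)

theorem centralizer_eq_of_mem_zpowers {G : Type u} [Group G] {x z : G}
    (h : Subgroup.zpowers x = Subgroup.zpowers z) :
    Subgroup.centralizer {x} = Subgroup.centralizer {z} := by
  rw [← Subgroup.centralizer_closure, ← Subgroup.zpowers_eq_closure, h,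
    Subgroup.zpowers_eq_closure, Subgroup.centralizer_closure]

theorem zpowers_eq_of_card_prime {G : Type u} [Group G] {p : ℕ} (hp : p.Prime) {P : Subgroup G}
    (hP : Nat.card P = p) {z : G} (hz : z ∈ P) (hz1 : z ≠ 1) : Subgroup.zpowers z = P := by
  have : Finite P := Nat.finite_of_card_ne_zero (hP ▸ hp.ne_zero)
  refine Subgroup.eq_of_le_of_card_ge (by simpa using hz) ?_
  have h := orderOf_dvd_natCard (⟨z, hz⟩ : P)
  rw [hP, Nat.dvd_prime hp, orderOf_eq_one_iff] at h
  rw [Nat.card_zpowers, hP]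
  rw [Subgroup.orderOf_mk] at h
  exact (h.resolve_left fun h => hz1 (congrArg Subtype.val h)).ge

theorem orderOf_eq_of_card_prime {G : Type u} [Group G] {p : ℕ} (hp : p.Prime) {P : Subgroup G}
    (hP : Nat.card P = p) {z : G} (hz : z ∈ P) (hz1 : z ≠ 1) : orderOf z = p := by
  rw [← Nat.card_zpowers, zpowers_eq_of_card_prime hp hP hz hz1, hP]

/-- If `P` were normal, its centralizer would be a normal subgroup of order 56 and index 3, leaving
112 elements outside it, all of order divisible by 3; only 56 are allowed. -/
theorem card_sylow_seven_ne_one {G : Type u} [Group G] [Finite G]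
    (hG : Nat.card G = 84 ∨ Nat.card G = 168) (h7 : singularCount G 7 = 48)
    (h3 : singularCount G 3 = 56) (P : Sylow 7 G) (hP : Nat.card P = 7) :
    Nat.card (Sylow 7 G) ≠ 1 := by
  classical
  intro h1
  have := Fintype.ofFinite G
  have hdvd : Nat.card G ∣ 168 := by rcases hG with h | h <;> rw [h]; norm_num
  have hp7 : Nat.Prime 7 := by norm_num
  have hss : Subsingleton (Sylow 7 G) := (Nat.card_eq_one_iff_unique.1 h1).1
  have hPn : (P : Subgroup G).Normal := P.normal_of_subsingleton
  have hmem : ∀ g : G, g ^ 120 ∈ P := by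
    intro g
    have h : IsPGroup 7 (Subgroup.zpowers (g ^ 120)) := by
      refine IsPGroup.of_card (n := (orderOf (g ^ 120)).factorization 7) ?_
      have : orderOf (g ^ 120) ∣ 7 := by
        rw [orderOf_dvd_iff_pow_eq_one, ← pow_mul, ← orderOf_dvd_iff_pow_eq_one]
        exact (orderOf_dvd_natCard g).trans (hdvd.trans (by norm_num))
      rw [Nat.card_zpowers]
      rcases (Nat.dvd_prime hp7).1 this with h | h <;> rw [h]
      · simp
      · rw [hp7.factorization_self, pow_one]
    obtain ⟨Q, hQ⟩ := h.exists_le_sylow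
    rw [Subsingleton.elim P Q]
    exact hQ (Subgroup.mem_zpowers _)
  obtain ⟨x, hx⟩ := exists_prime_orderOf_dvd_card' (G := P) 7 (by rw [hP])
  have hxP : (x : G) ∈ (P : Subgroup G) := x.2
  have hx1 : (x : G) ≠ 1 := fun h => by
    rw [show x = 1 from Subtype.ext h, orderOf_one] at hx; norm_num at hx
  have hcent : ∀ z ∈ (P : Subgroup G), z ≠ 1 →
      Subgroup.centralizer {z} = Subgroup.centralizer {(x : G)} := fun z hz hz1 =>
    centralizer_eq_of_mem_zpowers ((zpowers_eq_of_card_prime hp7 hP hz hz1).trans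
      (zpowers_eq_of_card_prime hp7 hP hxP hx1).symm)
  set C := Subgroup.centralizer {(x : G)} with hC
  set F := Nat.card {u : C // u ^ 120 = 1} with hF
  have hfib : ∀ z ∈ (P : Subgroup G), z ≠ 1 →
      (Finset.univ.filter fun g : G => g ^ 120 = z).card = F := by
    intro z hz hz1
    have h : z ^ 120 = z := by
      have : z ^ 7 = 1 := by
        rw [← orderOf_eq_of_card_prime hp7 hP hz hz1]; exact pow_orderOf_eq_one z
      calc z ^ 120 = (z ^ 7) ^ 17 * z := by rw [← pow_mul, ← pow_succ]
        _ = z := by rw [this, one_pow, one_mul]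
    rw [← Fintype.card_subtype, ← Nat.card_eq_fintype_card, card_pow_eq_of_pow_eq h,
      hcent z hz hz1]
  have hA : singularCount G 7 = (Finset.univ.filter fun g : G => g ^ 120 ≠ 1).card := by
    rw [singularCount, Nat.card_eq_fintype_card, Fintype.card_subtype]
    congr 1
    ext g
    simp [pow_eq_one_iff_not_seven_dvd hdvd]
  have hPcard : (Finset.univ.filter fun z : G => z ∈ (P : Subgroup G) ∧ z ≠ 1).card = 6 := by
    have : (Finset.univ.filter fun z : G => z ∈ (P : Subgroup G) ∧ z ≠ 1) =
        (Finset.univ.filter fun z : G => z ∈ (P : Subgroup G)).erase 1 := by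
      ext z; simp [and_comm]
    rw [this, Finset.card_erase_of_mem (by simp [one_mem]), ← Fintype.card_subtype,
      ← Nat.card_eq_fintype_card]
    exact congrArg (· - 1) hP
  -- The 48 elements of order divisible by 7 are spread evenly over their six possible 7-parts.
  have hF8 : F = 8 := by
    rw [Finset.card_eq_sum_card_fiberwise (f := fun g : G => g ^ 120)
      (t := Finset.univ.filter fun z : G => z ∈ (P : Subgroup G) ∧ z ≠ 1)
      (fun g hg => by simpa using ⟨hmem g, by simpa using hg⟩), Finset.sum_congr rfl
      (g := fun _ => F), Finset.sum_const, hPcard, h7, smul_eq_mul] at hA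
    · omega
    · intro z hz
      simp only [Finset.mem_filter, Finset.mem_univ, true_and] at hz
      rw [← hfib z hz.1 hz.2, Finset.filter_filter]
      congr 1
      ext g
      simp only [Finset.mem_filter, Finset.mem_univ, true_and, and_iff_right_iff_imp]
      rintro rfl
      exact hz.2
  -- Such an element commutes with its 7-part, a generator of `P`, so all 48 lie in `C`, besides the
  -- 8 counted by `F`.
  have hC56 : Nat.card C = 56 := by
    have hsplit := Finset.card_filter_add_card_filter_not (s := (Finset.univ : Finset C))
      (fun u => u ^ 120 = 1)
    rw [← Fintype.card_subtype, ← Nat.card_eq_fintype_card, ← hF, hF8, Finset.card_univ,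
      ← Nat.card_eq_fintype_card] at hsplit
    rw [← hsplit]
    have : (Finset.univ.filter fun u : C => ¬ u ^ 120 = 1).card = 48 := by
      rw [← h7, hA]
      refine Finset.card_bij (fun u _ => u.1) (fun u hu => ?_) (fun _ _ _ _ h => Subtype.ext h)
        fun g hg => ?_
      · simp only [Finset.mem_filter, Finset.mem_univ, true_and] at hu ⊢
        exact fun h => hu (Subtype.ext h)
      · simp only [Finset.mem_filter, Finset.mem_univ, true_and] at hg
        have hgC : g ∈ C := by
          rw [← hcent _ (hmem g) hg, Subgroup.mem_centralizer_singleton_iff]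
          exact (Commute.self_pow g 120).eq
        refine ⟨⟨g, hgC⟩, ?_, rfl⟩
        simp only [Finset.mem_filter, Finset.mem_univ, true_and]
        exact fun h => hg (congrArg Subtype.val h)
    rw [this]
  have hidx := C.index_mul_card
  rw [hC56] at hidx
  have hidx3 : C.index = 3 := by omega
  have hCP : C = Subgroup.centralizer ((P : Subgroup G) : Set G) := by
    rw [hC, ← Subgroup.centralizer_closure {(x : G)}, ← Subgroup.zpowers_eq_closure,
      zpowers_eq_of_card_prime hp7 hP hxP hx1]
  have hCn : C.Normal := by rw [hCP]; infer_instance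
  have hsub : ∀ g : G, g ∉ C → 3 ∣ orderOf g := by
    intro g hg
    have h1 : (QuotientGroup.mk g : G ⧸ C) ≠ 1 := fun h => hg ((QuotientGroup.eq_one_iff g).1 h)
    have h2 := orderOf_dvd_natCard (QuotientGroup.mk g : G ⧸ C)
    rw [← Subgroup.index_eq_card, hidx3, Nat.dvd_prime Nat.prime_three, orderOf_eq_one_iff] at h2
    rw [← h2.resolve_left h1]
    exact orderOf_map_dvd (QuotientGroup.mk' C) g
  have hle : (Finset.univ.filter fun g : G => g ∉ C).card ≤ singularCount G 3 := by
    rw [singularCount, Nat.card_eq_fintype_card, Fintype.card_subtype]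
    exact Finset.card_le_card fun g hg => by simpa using hsub g (by simpa using hg)
  have hsplit := Finset.card_filter_add_card_filter_not (s := (Finset.univ : Finset G))
    (fun g => g ∈ C)
  rw [← Fintype.card_subtype, ← Nat.card_eq_fintype_card, Finset.card_univ,
      ← Nat.card_eq_fintype_card (α := G)] at hsplit
  have : Nat.card {g // g ∈ C} = 56 := hC56
  omega

theorem card_and_card_sylow_seven {G : Type u} [Group G] [Finite G]
    (hG : Nat.card G = 84 ∨ Nat.card G = 168) (h7 : singularCount G 7 = 48)
    (h3 : singularCount G 3 = 56) : Nat.card G = 168 ∧ Nat.card (Sylow 7 G) = 8 := by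
  obtain ⟨P⟩ : Nonempty (Sylow 7 G) := inferInstance
  have hP : Nat.card P = 7 := by
    have := P.card_eq_multiplicity
    have h2 : (Nat.card G).factorization 7 = 1 := by
      rcases hG with h | h <;> rw [h]
      · rw [show 84 = 7 * 12 from rfl, Nat.factorization_mul (by norm_num) (by norm_num)]
        simp [Nat.factorization_eq_zero_of_not_dvd (show ¬ 7 ∣ 12 by norm_num),
          Nat.Prime.factorization_self (show Nat.Prime 7 by norm_num)]
      · rw [show 168 = 7 * 24 from rfl, Nat.factorization_mul (by norm_num) (by norm_num)]
        simp [Nat.factorization_eq_zero_of_not_dvd (show ¬ 7 ∣ 24 by norm_num),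
          Nat.Prime.factorization_self (show Nat.Prime 7 by norm_num)]
    rwa [h2, pow_one] at this
  have hne := card_sylow_seven_ne_one hG h7 h3 P hP
  have hmod := card_sylow_modEq_one 7 G
  have hdvd := P.card_dvd_index
  have hidx := (P : Subgroup G).index_mul_card
  rw [show Nat.card (P : Subgroup G) = 7 from hP] at hidx
  set k := Nat.card (Sylow 7 G)
  have hd24 : k ∣ 24 := hdvd.trans (by
    rcases hG with h | h
    · exact ⟨2, by omega⟩
    · exact ⟨1, by omega⟩)
  have hk : k = 8 := by
    have : k ≤ 24 := Nat.le_of_dvd (by norm_num) hd24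
    unfold Nat.ModEq at hmod
    interval_cases k <;> omega
  refine ⟨hG.resolve_left fun h => ?_, hk⟩
  have : (P : Subgroup G).index = 12 := by omega
  rw [this, hk] at hdvd
  norm_num at hdvd

/-- Sylow subgroups of order `p` meet trivially in pairs, so they already contain `n_p(p - 1)`
elements of order `p`, which leaves no room for others of order divisible by `p`. -/
theorem orderOf_eq_of_dvd_of_singularCount_le {G : Type u} [Group G] [Finite G] {p : ℕ}
    [hp : Fact p.Prime] (hP : ∀ P : Sylow p G, Nat.card P = p)
    (h : singularCount G p ≤ Nat.card (Sylow p G) * (p - 1)) {g : G} (hg : p ∣ orderOf g) :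
    orderOf g = p := by
  classical
  have := Fintype.ofFinite G
  have := Fintype.ofFinite (Sylow p G)
  let f : (Σ P : Sylow p G, {z : P // z ≠ 1}) → {g : G // orderOf g = p} := fun a =>
    ⟨a.2.1.1, orderOf_eq_of_card_prime hp.out (hP a.1) a.2.1.2 fun h => a.2.2 (Subtype.ext h)⟩
  have hf : Function.Injective f := by
    rintro ⟨P, ⟨⟨z, hz⟩, hz1⟩⟩ ⟨Q, ⟨⟨w, hw⟩, hw1⟩⟩ hzw
    obtain rfl : z = w := congrArg Subtype.val hzw
    have hz1' : z ≠ 1 := fun h => hz1 (Subtype.ext h)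
    obtain rfl : P = Q := Sylow.ext ((zpowers_eq_of_card_prime hp.out (hP P) hz hz1').symm.trans
      (zpowers_eq_of_card_prime hp.out (hP Q) hw hz1'))
    rfl
  have hcard : Nat.card (Σ P : Sylow p G, {z : P // z ≠ 1}) =
      Nat.card (Sylow p G) * (p - 1) := by
    rw [Nat.card_sigma, Finset.sum_congr rfl (g := fun _ => p - 1)]
    · simp
    · intro P _
      rw [Nat.card_eq_fintype_card, Fintype.card_subtype_compl, ← Nat.card_eq_fintype_card,
        Fintype.card_subtype_eq]
      exact congrArg (· - 1) (hP P)
  have hle := Nat.card_le_card_of_injective f hf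
  rw [hcard] at hle
  let i : {g : G // orderOf g = p} → {g : G // p ∣ orderOf g} := fun g => ⟨g.1, by rw [g.2]⟩
  have hi : Function.Injective i := fun a b hab => Subtype.ext (by simpa [i] using hab)
  have hbij := (Nat.bijective_iff_injective_and_card i).2
    ⟨hi, le_antisymm (Nat.card_le_card_of_injective i hi) (h.trans hle)⟩
  obtain ⟨a, ha⟩ := hbij.2 ⟨g, hg⟩
  rw [← show a.1 = g from congrArg Subtype.val ha]
  exact a.2

/-! ### The action on eight Sylow 7-subgroups. -/

section order168

variable {G : Type u} [Group G]

/-- Given distinct Sylow 7-subgroups `P` and `Q` and a generator `x` of `P`, the Sylow 7-subgroups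
are labelled by the projective line over `𝔽₇`. -/
def sylowLabel (P Q : Sylow 7 G) (x : G) : Option (ZMod 7) → Sylow 7 G
  | none => P
  | some i => x ^ i.val • Q

theorem sylowLabel_natCast {x : G} (hx : orderOf x = 7) (P Q : Sylow 7 G) (n : ℕ) :
    sylowLabel P Q x (some (n : ZMod 7)) = x ^ n • Q := by
  simp only [sylowLabel, ZMod.val_natCast]
  rw [show x ^ (n % 7) = x ^ n by rw [← hx, pow_mod_orderOf]]

variable [Finite G]

theorem card_sylow_seven_of_card (hG : Nat.card G = 168) (P : Sylow 7 G) : Nat.card P = 7 := by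
  have := P.card_eq_multiplicity
  rwa [hG, show 168 = 7 * 24 from rfl, Nat.factorization_mul (by norm_num) (by norm_num),
    Finsupp.add_apply, Nat.factorization_eq_zero_of_not_dvd (show ¬ 7 ∣ 24 by norm_num),
    Nat.Prime.factorization_self (show Nat.Prime 7 by norm_num), add_zero, pow_one] at this

theorem card_sylow_three_of_card (hG : Nat.card G = 168) (P : Sylow 3 G) : Nat.card P = 3 := by
  have := P.card_eq_multiplicity
  rwa [hG, show 168 = 3 * 56 from rfl, Nat.factorization_mul (by norm_num) (by norm_num),
    Finsupp.add_apply, Nat.factorization_eq_zero_of_not_dvd (show ¬ 3 ∣ 56 by norm_num),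
    Nat.Prime.factorization_self (show Nat.Prime 3 by norm_num), add_zero, pow_one] at this

theorem card_normalizer_sylow_seven (hG : Nat.card G = 168) (hn : Nat.card (Sylow 7 G) = 8)
    (P : Sylow 7 G) : Nat.card (Subgroup.normalizer (P : Set G)) = 21 := by
  have h := (Subgroup.normalizer (P : Set G)).index_mul_card
  rw [← P.card_eq_index_normalizer, hn, hG] at h
  omega

/-- Since `z` generates `P`, all of `P` normalizes `Q`, and a 7-subgroup normalizing a Sylow
7-subgroup lies in it. -/
theorem sylow_eq_of_smul_eq (hG : Nat.card G = 168) {P Q : Sylow 7 G} {z : G} (hz : z ∈ P)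
    (hz1 : z ≠ 1) (h : z • Q = Q) : P = Q := by
  have h7 : Nat.Prime 7 := by norm_num
  rw [Sylow.smul_eq_iff_mem_normalizer] at h
  have hzP := zpowers_eq_of_card_prime h7 (card_sylow_seven_of_card hG P) hz hz1
  have hle : (P : Subgroup G) ≤ Subgroup.normalizer (Q : Set G) := by
    rw [← hzP]; simpa using h
  have h2 := P.isPGroup'.inf_normalizer_sylow Q
  rw [inf_eq_left.2 hle] at h2
  refine Sylow.ext (Subgroup.eq_of_le_of_card_ge (inf_eq_left.1 h2.symm) ?_)
  exact ((card_sylow_seven_of_card hG Q).trans (card_sylow_seven_of_card hG P).symm).le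

theorem orderOf_dvd_of_smul_eq (hG : Nat.card G = 168) (hn : Nat.card (Sylow 7 G) = 8)
    {P : Sylow 7 G} {g : G} (h : g • P = P) : orderOf g ∣ 21 := by
  rw [Sylow.smul_eq_iff_mem_normalizer] at h
  have := orderOf_dvd_natCard (⟨g, h⟩ : Subgroup.normalizer (P : Set G))
  rwa [card_normalizer_sylow_seven hG hn, Subgroup.orderOf_mk] at this

theorem orderOf_eq_seven (hG : Nat.card G = 168) (hn : Nat.card (Sylow 7 G) = 8)
    (h7 : singularCount G 7 = 48) {g : G} (hg : 7 ∣ orderOf g) : orderOf g = 7 :=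
  orderOf_eq_of_dvd_of_singularCount_le (card_sylow_seven_of_card hG) (by rw [h7, hn]) hg

theorem orderOf_eq_three_of_smul_eq (hG : Nat.card G = 168) (hn : Nat.card (Sylow 7 G) = 8)
    (h7 : singularCount G 7 = 48) {P Q : Sylow 7 G} (hPQ : P ≠ Q) {g : G} (hP : g • P = P)
    (hQ : g • Q = Q) (hg : g ≠ 1) : orderOf g = 3 := by
  have h := orderOf_dvd_of_smul_eq hG hn hP
  by_cases hd : 7 ∣ orderOf g
  · have ho := orderOf_eq_seven hG hn h7 hd
    have hp : IsPGroup 7 (Subgroup.zpowers g) :=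
      IsPGroup.of_card (n := 1) (by rw [Nat.card_zpowers, ho, pow_one])
    obtain ⟨R, hR⟩ := hp.exists_le_sylow
    have hgR : g ∈ R := hR (Subgroup.mem_zpowers g)
    exact absurd ((sylow_eq_of_smul_eq hG hgR hg hP).symm.trans
      (sylow_eq_of_smul_eq hG hgR hg hQ)) hPQ
  · have h2 : (orderOf g).Coprime 7 :=
      ((Nat.Prime.coprime_iff_not_dvd (by norm_num)).2 hd).symm
    have h3 := h2.dvd_of_dvd_mul_left (show orderOf g ∣ 7 * 3 from h)
    rw [Nat.dvd_prime Nat.prime_three, orderOf_eq_one_iff] at h3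
    exact h3.resolve_left hg

theorem sylowLabel_bijective (hG : Nat.card G = 168) (hn : Nat.card (Sylow 7 G) = 8)
    {P Q : Sylow 7 G} (hPQ : P ≠ Q) {x : G} (hxP : x ∈ P) (hx : orderOf x = 7) :
    Function.Bijective (sylowLabel P Q x) := by
  rw [Nat.bijective_iff_injective_and_card]
  refine ⟨?_, by rw [hn, Nat.card_eq_fintype_card]; rfl⟩
  have hfix : ∀ n : ℕ, x ^ n • P = P := fun n => by
    rw [Sylow.smul_eq_iff_mem_normalizer]
    exact Subgroup.le_normalizer (pow_mem hxP n)
  have hne : ∀ n : ℕ, x ^ n • Q ≠ P := fun n h => hPQ (by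
    rw [← hfix n] at h; exact (smul_left_cancel _ h).symm)
  have key : ∀ a b : ℕ, a < 7 → a ≤ b → b < 7 → x ^ a • Q = x ^ b • Q → a = b := by
    intro a b _ hab hb h
    by_contra hne
    rw [show b = a + (b - a) by omega, pow_add, mul_smul] at h
    have h2 := (smul_left_cancel _ h).symm
    refine hPQ (sylow_eq_of_smul_eq hG (pow_mem hxP (b - a)) (fun h1 => ?_) h2)
    have := orderOf_dvd_of_pow_eq_one h1
    rw [hx] at this
    have := Nat.le_of_dvd (by omega) this
    omega
  rintro (_ | i) (_ | j) h
  · rfl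
  · exact absurd h.symm (hne _)
  · exact absurd h (hne _)
  · have hi := ZMod.val_lt i
    have hj := ZMod.val_lt j
    have : i.val = j.val := by
      rcases le_total i.val j.val with hle | hle
      · exact key _ _ hi hle hj h
      · exact (key _ _ hj hle hi h.symm).symm
    rw [ZMod.val_injective 7 this]

theorem exists_orderOf_eq_three_of_smul_eq (hG : Nat.card G = 168)
    (hn : Nat.card (Sylow 7 G) = 8) (h7 : singularCount G 7 = 48) {P Q : Sylow 7 G}
    (hPQ : P ≠ Q) {x : G} (hxP : x ∈ P) (hx : orderOf x = 7) :
    ∃ y : G, y • P = P ∧ y • Q = Q ∧ orderOf y = 3 ∧ y * x * y⁻¹ = x ^ 2 := by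
  have : Fact (Nat.Prime 3) := ⟨Nat.prime_three⟩
  have hp7 : Nat.Prime 7 := by norm_num
  have hx1 : x ≠ 1 := fun h => by rw [h, orderOf_one] at hx; norm_num at hx
  obtain ⟨y₀, hy₀⟩ := exists_prime_orderOf_dvd_card' (G := Subgroup.normalizer (P : Set G)) 3
    (by rw [card_normalizer_sylow_seven hG hn]; norm_num)
  have hy₀P : (y₀ : G) • P = P := Sylow.smul_eq_iff_mem_normalizer.2 y₀.2
  -- The powers of `x` are transitive on the Sylow 7-subgroups other than `P`, so one of them
  -- corrects `y₀` to fix `Q`.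
  obtain ⟨y, hyP, hyQ, hy1⟩ : ∃ y : G, y • P = P ∧ y • Q = Q ∧ y ≠ 1 := by
    obtain ⟨i, hi⟩ := (sylowLabel_bijective hG hn hPQ hxP hx).2 ((y₀ : G) • Q)
    rcases i with _ | i
    · change P = _ at hi
      exact absurd (smul_left_cancel _ (hy₀P.trans hi)) hPQ
    · change x ^ i.val • Q = _ at hi
      refine ⟨(x ^ i.val)⁻¹ * y₀, ?_, ?_, ?_⟩
      · rw [mul_smul, hy₀P, inv_smul_eq_iff]
        exact (Sylow.smul_eq_iff_mem_normalizer.2 (Subgroup.le_normalizer (pow_mem hxP _))).symm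
      · rw [mul_smul, inv_smul_eq_iff, hi]
      · intro h
        rw [inv_mul_eq_one] at h
        have h2 : (y₀ : G) ^ 7 = 1 := by
          rw [← h, ← pow_mul, mul_comm, pow_mul, orderOf_dvd_iff_pow_eq_one.1 hx.dvd, one_pow]
        have := orderOf_dvd_of_pow_eq_one h2
        rw [Subgroup.orderOf_coe, hy₀] at this
        norm_num at this
  have hy3 := orderOf_eq_three_of_smul_eq hG hn h7 hPQ hyP hyQ hy1
  have hyx : y * x * y⁻¹ ∈ Subgroup.zpowers x := by
    rw [zpowers_eq_of_card_prime hp7 (card_sylow_seven_of_card hG P) hxP hx1]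
    rw [Sylow.smul_eq_iff_mem_normalizer] at hyP
    exact (Subgroup.mem_normalizer_iff.1 hyP x).1 hxP
  rw [← mem_powers_iff_mem_zpowers, Submonoid.mem_powers_iff] at hyx
  obtain ⟨k, hk⟩ := hyx
  have hconj : ∀ (g : G) (a n : ℕ), g * x * g⁻¹ = x ^ a → g * x ^ n * g⁻¹ = x ^ (a * n) := by
    intro g a n h
    rw [← conj_pow, h, pow_mul]
  have hk2 : y ^ 2 * x * (y ^ 2)⁻¹ = x ^ (k * k) := by
    rw [← hconj y k k hk.symm, hk, pow_two, mul_inv_rev]; simp only [mul_assoc]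
  have hk3 : x ^ (k * (k * k)) = x ^ 1 := by
    rw [← hconj y k _ hk.symm, ← hk2]
    have : y ^ 3 = 1 := by rw [← hy3]; exact pow_orderOf_eq_one y
    calc _ = y ^ 3 * x * (y ^ 3)⁻¹ := by group
      _ = _ := by rw [this]; simp
  rw [pow_eq_pow_iff_modEq, hx] at hk3
  -- Otherwise `x * y` would have order 21.
  have hk1 : ¬ k ≡ 1 [MOD 7] := by
    intro h
    have h2 : x ^ k = x ^ 1 := by rw [pow_eq_pow_iff_modEq, hx]; exact h
    rw [h2, pow_one, eq_mul_inv_iff_mul_eq] at hk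
    have hc : Commute x y := hk
    have ho := hc.orderOf_mul_eq_mul_orderOf_of_coprime (by rw [hx, hy3]; norm_num)
    have h3 := orderOf_eq_seven hG hn h7 (g := x * y) (by rw [ho, hx]; exact dvd_mul_right _ _)
    rw [ho, hx, hy3] at h3
    norm_num at h3
  -- The nontrivial cube roots of 1 modulo 7 are 2 and 4; in the second case `y ^ 2` replaces `y`.
  have hcases : k ≡ 2 [MOD 7] ∨ k * k ≡ 2 [MOD 7] := by
    unfold Nat.ModEq at *
    have hlt := Nat.mod_lt k (show 7 > 0 by norm_num)
    simp only [Nat.mul_mod k] at *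
    generalize k % 7 = j at *
    interval_cases j <;> simp at *
  rcases hcases with h | h
  · exact ⟨y, hyP, hyQ, hy3, by rw [← hk, pow_eq_pow_iff_modEq, hx]; exact h⟩
  · refine ⟨y ^ 2, ?_, ?_, ?_, by rw [hk2, pow_eq_pow_iff_modEq, hx]; exact h⟩
    · rw [pow_two, mul_smul, hyP, hyP]
    · rw [pow_two, mul_smul, hyQ, hyQ]
    · rw [orderOf_pow, hy3]; rfl

end order168

/-! ### The model group on the projective line. -/

/-- The translation `i ↦ i + 1` of the projective line over `𝔽₇`. -/
def lineTranslation : Equiv.Perm (Option (ZMod 7)) where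
  toFun := Option.map (· + 1)
  invFun := Option.map (· - 1)
  left_inv := by decide
  right_inv := by decide

/-- The homothety `i ↦ 2 * i` of the projective line over `𝔽₇`. -/
def lineHomothety : Equiv.Perm (Option (ZMod 7)) where
  toFun := Option.map (2 * ·)
  invFun := Option.map (4 * ·)
  left_inv := by decide
  right_inv := by decide

/-- The involution `i ↦ -1 / i` of the projective line over `𝔽₇`, with `i⁻¹ = i ^ 5`. -/
def lineInversion : Equiv.Perm (Option (ZMod 7)) :=
  Function.Involutive.toPerm
    (fun z => z.elim (some 0) fun i => if i = 0 then none else some (-i ^ 5))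
    (by unfold Function.Involutive; decide)

/-- The group of permutations of the projective line over `𝔽₇` generated by `i ↦ i + 1`,
`i ↦ 2 * i` and `i ↦ -1 / i`. -/
def lineGroup : Subgroup (Equiv.Perm (Option (ZMod 7))) :=
  Subgroup.closure {lineTranslation, lineHomothety, lineInversion}

theorem lineTranslation_mem : lineTranslation ∈ lineGroup := Subgroup.subset_closure (by simp)

theorem lineHomothety_mem : lineHomothety ∈ lineGroup := Subgroup.subset_closure (by simp)

theorem lineInversion_mem : lineInversion ∈ lineGroup := Subgroup.subset_closure (by simp)

/-- The factors 7 and 3 are orders of generators; 8 comes from transitivity on the line. This lower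
bound is all that is needed. -/
theorem dvd_card_lineGroup : 168 ∣ Nat.card lineGroup := by
  have : Fact (Nat.Prime 3) := ⟨Nat.prime_three⟩
  have h7 : 7 ∣ Nat.card lineGroup := by
    have h := orderOf_eq_prime (show lineTranslation ^ 7 = 1 by decide +kernel)
      (show lineTranslation ≠ 1 by decide +kernel)
    exact h.symm.dvd.trans (Subgroup.orderOf_dvd_natCard _ lineTranslation_mem)
  have h3 : 3 ∣ Nat.card lineGroup := by
    have h := orderOf_eq_prime (show lineHomothety ^ 3 = 1 by decide +kernel)
      (show lineHomothety ≠ 1 by decide +kernel)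
    exact h.symm.dvd.trans (Subgroup.orderOf_dvd_natCard _ lineHomothety_mem)
  have h8 : 8 ∣ Nat.card lineGroup := by
    have horb : MulAction.orbit lineGroup (none : Option (ZMod 7)) = Set.univ := by
      rw [Set.eq_univ_iff_forall]
      rintro (_ | i)
      · exact MulAction.mem_orbit_self _
      · refine ⟨⟨lineTranslation ^ i.val * lineInversion,
          mul_mem (pow_mem lineTranslation_mem _) lineInversion_mem⟩, ?_⟩
        change (lineTranslation ^ i.val * lineInversion) none = some i
        revert i
        decide +kernel
    have h := (MulAction.stabilizer lineGroup (none : Option (ZMod 7))).index_dvd_card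
    rw [MulAction.index_stabilizer, horb, Set.ncard_univ, Nat.card_eq_fintype_card] at h
    exact h
  have h56 : 7 * 8 ∣ Nat.card lineGroup :=
    Nat.Coprime.mul_dvd_of_dvd_of_dvd (by norm_num) h7 h8
  exact Nat.Coprime.mul_dvd_of_dvd_of_dvd (by norm_num : Nat.Coprime 3 (7 * 8)) h3 h56

/-- With `c = f(1)`, the hypotheses force `f(z) = c / z`. If `c` is a nonzero square, `f` has a
fixed point; otherwise `c` is 3, 5 or 6, and multiplying by a power of 2 turns it into `6 = -1`. -/
theorem exists_homothety_pow_mul_eq_lineInversion {f : Option (ZMod 7) → Option (ZMod 7)}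
    (hnone : f none = some 0) (hinv : ∀ z, f (f z) = z) (hfix : ∀ z, f z ≠ z)
    (hhom : ∀ z, f (lineHomothety z) = lineHomothety (lineHomothety (f z))) :
    ∃ k : ℕ, ∀ z, (lineHomothety ^ k) (f z) = lineInversion z := by
  have hzero : f (some 0) = none := by rw [← hnone, hinv]
  obtain ⟨c, hc⟩ : ∃ c, f (some 1) = some c := by
    rcases h : f (some 1) with _ | c
    · have := hinv (some 1)
      rw [h, hnone] at this
      exact absurd this (by decide)
    · exact ⟨c, rfl⟩
  have h2 : f (some 2) = some (4 * c) := by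
    have h := hhom (some 1)
    rw [hc] at h
    change f (some (2 * 1)) = some (2 * (2 * c)) at h
    rw [mul_one, ← mul_assoc] at h
    exact h
  have h4 : f (some 4) = some (2 * c) := by
    have h := hhom (some 2)
    rw [h2] at h
    change f (some (2 * 2)) = some (2 * (2 * (4 * c))) at h
    rw [show (2 * (2 * (4 * c)) : ZMod 7) = 2 * c from
      (by decide : ∀ c : ZMod 7, 2 * (2 * (4 * c)) = 2 * c) c] at h
    exact h
  have i1 := hinv (some 1)
  have i2 := hinv (some 2)
  have i4 := hinv (some 4)
  rw [hc] at i1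
  rw [h2] at i2
  rw [h4] at i4
  have hall : ∀ k : ℕ, (∀ z ∈ ({none, some 0, some 1, some 2, some 4, some c, some (4 * c),
      some (2 * c)} : Finset (Option (ZMod 7))), (lineHomothety ^ k) (f z) = lineInversion z) →
      (({none, some 0, some 1, some 2, some 4, some c, some (4 * c),
      some (2 * c)} : Finset (Option (ZMod 7))) = Finset.univ) →
      ∃ k : ℕ, ∀ z, (lineHomothety ^ k) (f z) = lineInversion z := fun k h hu =>
    ⟨k, fun z => h z (hu ▸ Finset.mem_univ z)⟩
  have hc' : c = 0 ∨ c = 1 ∨ c = 2 ∨ c = 3 ∨ c = 4 ∨ c = 5 ∨ c = 6 :=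
    (by decide : ∀ c : ZMod 7, c = 0 ∨ c = 1 ∨ c = 2 ∨ c = 3 ∨ c = 4 ∨ c = 5 ∨ c = 6) c
  rcases hc' with rfl | rfl | rfl | rfl | rfl | rfl | rfl
  · rw [hzero] at i1; exact absurd i1 (by decide)
  · exact absurd hc (hfix _)
  · exact absurd h4 (hfix _)
  · refine hall 1 ?_ (by decide)
    simp only [Finset.mem_insert, Finset.mem_singleton, forall_eq_or_imp, forall_eq,
      hnone, hzero, hc, h2, h4, i1, i2, i4]
    decide
  · exact absurd h2 (hfix _)
  · refine hall 2 ?_ (by decide)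
    simp only [Finset.mem_insert, Finset.mem_singleton, forall_eq_or_imp, forall_eq,
      hnone, hzero, hc, h2, h4, i1, i2, i4]
    decide
  · refine hall 0 ?_ (by decide)
    simp only [Finset.mem_insert, Finset.mem_singleton, forall_eq_or_imp, forall_eq,
      hnone, hzero, hc, h2, h4, i1, i2, i4]
    decide

/-! ### Standard generators of `G`. -/

section order168

variable {G : Type u} [Group G]

theorem smul_sylowLabel_some {P Q : Sylow 7 G} {x y : G} (hx : orderOf x = 7) (hyQ : y • Q = Q)
    (hyx : y * x * y⁻¹ = x ^ 2) (i : ZMod 7) :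
    y • sylowLabel P Q x (some i) = sylowLabel P Q x (some (2 * i)) := by
  have h : (2 * i : ZMod 7) = ((2 * i.val : ℕ) : ZMod 7) := by
    rw [Nat.cast_mul, ZMod.natCast_zmod_val, Nat.cast_ofNat]
  rw [h, sylowLabel_natCast hx, pow_mul, ← hyx, conj_pow, mul_smul, mul_smul,
    inv_smul_eq_iff.2 hyQ.symm]
  rfl

variable [Finite G]

theorem mem_zpowers_of_smul_eq (hG : Nat.card G = 168) (hn : Nat.card (Sylow 7 G) = 8)
    (h7 : singularCount G 7 = 48) {P Q : Sylow 7 G} (hPQ : P ≠ Q) {y : G} (hyP : y • P = P)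
    (hyQ : y • Q = Q) (hy3 : orderOf y = 3) {g : G} (hgP : g • P = P) (hgQ : g • Q = Q) :
    g ∈ Subgroup.zpowers y := by
  let D : Subgroup G := MulAction.stabilizer G P ⊓ MulAction.stabilizer G Q
  have hD21 : Nat.card D ∣ 21 := by
    rw [← card_normalizer_sylow_seven hG hn P]
    exact Subgroup.card_dvd_of_le fun d hd => Sylow.smul_eq_iff_mem_normalizer.1 hd.1
  have hD7 : ¬ 7 ∣ Nat.card D := fun h => by
    obtain ⟨d, hd⟩ := exists_prime_orderOf_dvd_card' 7 h
    rw [← Subgroup.orderOf_coe] at hd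
    have := orderOf_eq_three_of_smul_eq hG hn h7 hPQ d.2.1 d.2.2 fun h1 => by
      rw [h1, orderOf_one] at hd
      norm_num at hd
    omega
  have hD3 : Nat.card D ∣ 3 := Nat.Coprime.dvd_of_dvd_mul_left
    ((Nat.Prime.coprime_iff_not_dvd (by norm_num)).2 hD7).symm (show Nat.card D ∣ 7 * 3 from hD21)
  have hle : Subgroup.zpowers y ≤ D := by
    rw [Subgroup.zpowers_le]; exact ⟨hyP, hyQ⟩
  have := Subgroup.eq_of_le_of_card_ge hle (by
    rw [Nat.card_zpowers, hy3]; exact Nat.le_of_dvd (by norm_num) hD3)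
  rw [this]
  exact ⟨hgP, hgQ⟩

/-- The normalizer permutes the fixed points `P`, `Q` of `y`; those elements fixing both lie in
`⟨y⟩`, and those swapping them in `t⁻¹⟨y⟩`. -/
theorem card_normalizer_zpowers_le {P Q : Sylow 7 G} (hPQ : P ≠ Q) {y t : G} (htP : t • P = Q)
    (htQ : t • Q = P) (hyP : y • P = P) (hyQ : y • Q = Q) (hy3 : orderOf y = 3)
    (hD : ∀ g : G, g • P = P → g • Q = Q → g ∈ Subgroup.zpowers y)
    (hfix : ∀ R : Sylow 7 G, y • R = R → R = P ∨ R = Q) :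
    Nat.card (Subgroup.normalizer (Subgroup.zpowers y : Set G)) ≤ 6 := by
  have hDP : ∀ g ∈ Subgroup.zpowers y, g • P = P := fun g hg =>
    (show Subgroup.zpowers y ≤ MulAction.stabilizer G P by rwa [Subgroup.zpowers_le]) hg
  have hDQ : ∀ g ∈ Subgroup.zpowers y, g • Q = Q := fun g hg =>
    (show Subgroup.zpowers y ≤ MulAction.stabilizer G Q by rwa [Subgroup.zpowers_le]) hg
  have hsub : (Subgroup.normalizer (Subgroup.zpowers y : Set G) : Set G) ⊆
      (Subgroup.zpowers y : Set G) ∪ (t⁻¹ * ·) '' (Subgroup.zpowers y : Set G) := by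
    intro g hg
    have hgy : g⁻¹ * y * g ∈ Subgroup.zpowers y := by
      have := (Subgroup.mem_normalizer_iff.1 (inv_mem hg) y).1 (Subgroup.mem_zpowers y)
      rwa [inv_inv] at this
    have hmove : ∀ R : Sylow 7 G, (g⁻¹ * y * g) • R = R → y • g • R = g • R := fun R hR => by
      rwa [mul_assoc, mul_smul, inv_smul_eq_iff, mul_smul] at hR
    have hne : g • P ≠ g • Q := fun h => hPQ (smul_left_cancel _ h)
    rcases hfix _ (hmove P (hDP _ hgy)) with h1 | h1 <;>
      rcases hfix _ (hmove Q (hDQ _ hgy)) with h2 | h2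
    · exact absurd (h1.trans h2.symm) hne
    · exact Or.inl (hD g h1 h2)
    · refine Or.inr ⟨t * g, hD _ ?_ ?_, by simp⟩
      · rw [mul_smul, h1, htQ]
      · rw [mul_smul, h2, htP]
    · exact absurd (h1.trans h2.symm) hne
  have h3 : (Subgroup.zpowers y : Set G).ncard = 3 := by
    rw [← hy3, ← Nat.card_zpowers]; rfl
  calc Nat.card (Subgroup.normalizer (Subgroup.zpowers y : Set G))
      = (Subgroup.normalizer (Subgroup.zpowers y : Set G) : Set G).ncard := rfl
    _ ≤ _ := Set.ncard_le_ncard hsub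
    _ ≤ _ := Set.ncard_union_le _ _
    _ ≤ 3 + 3 := Nat.add_le_add h3.le ((Set.ncard_image_le (Set.toFinite _)).trans h3.le)

/-- There are at least `168 / 6 = 28` Sylow 3-subgroups, whose `28 · 2 = 56` elements of order 3
exhaust `singularCount G 3`. -/
theorem orderOf_eq_three_of_card_normalizer_le (hG : Nat.card G = 168)
    (h3 : singularCount G 3 = 56) {y : G} (hy3 : orderOf y = 3)
    (hle : Nat.card (Subgroup.normalizer (Subgroup.zpowers y : Set G)) ≤ 6) {g : G}
    (hg : 3 ∣ orderOf g) : orderOf g = 3 := by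
  have : Fact (Nat.Prime 3) := ⟨Nat.prime_three⟩
  refine orderOf_eq_of_dvd_of_singularCount_le (card_sylow_three_of_card hG) ?_ hg
  have hp : IsPGroup 3 (Subgroup.zpowers y) :=
    IsPGroup.of_card (n := 1) (by rw [Nat.card_zpowers, hy3, pow_one])
  obtain ⟨S, hS⟩ := hp.exists_le_sylow
  have hSy : Subgroup.zpowers y = S := Subgroup.eq_of_le_of_card_ge hS (by
    rw [Nat.card_zpowers, hy3]; exact (card_sylow_three_of_card hG S).le)
  have hidx := (Subgroup.normalizer (S : Set G)).index_mul_card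
  rw [← S.card_eq_index_normalizer, hG] at hidx
  have hle' : Nat.card (Subgroup.normalizer (S : Set G)) ≤ 6 := by
    rw [hSy] at hle; exact hle
  rw [h3]
  nlinarith

theorem exists_standard_generators (hG : Nat.card G = 168) (hn : Nat.card (Sylow 7 G) = 8)
    (h7 : singularCount G 7 = 48) (h3 : singularCount G 3 = 56) :
    ∃ (P Q : Sylow 7 G) (x y t : G), P ≠ Q ∧ x ∈ P ∧ orderOf x = 7 ∧ y • P = P ∧ y • Q = Q ∧
      y * x * y⁻¹ = x ^ 2 ∧ t • P = Q ∧ t * t = 1 ∧ (∀ R : Sylow 7 G, t • R ≠ R) ∧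
      t * y = y * y * t := by
  classical
  obtain ⟨P⟩ : Nonempty (Sylow 7 G) := inferInstance
  obtain ⟨t, ht⟩ := exists_prime_orderOf_dvd_card' (G := G) 2 (by rw [hG]; norm_num)
  have htt : t * t = 1 := by rw [← pow_two]; exact orderOf_dvd_iff_pow_eq_one.1 ht.dvd
  -- Point stabilizers have odd order 21.
  have htfix : ∀ R : Sylow 7 G, t • R ≠ R := fun R hR => by
    have := orderOf_dvd_of_smul_eq hG hn hR
    rw [ht] at this
    norm_num at this
  obtain ⟨x, hx⟩ := exists_prime_orderOf_dvd_card' (G := P) 7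
    (card_sylow_seven_of_card hG P).symm.dvd
  rw [← Subgroup.orderOf_coe] at hx
  have hPQ : P ≠ t • P := (htfix P).symm
  obtain ⟨y, hyP, hyQ, hy3, hyx⟩ := exists_orderOf_eq_three_of_smul_eq hG hn h7 hPQ x.2 hx
  have htQ : t • t • P = P := by rw [← mul_smul, htt, one_smul]
  have hD : ∀ g : G, g • P = P → g • t • P = t • P → g ∈ Subgroup.zpowers y := fun g h1 h2 =>
    mem_zpowers_of_smul_eq hG hn h7 hPQ hyP hyQ hy3 h1 h2
  have hbij := sylowLabel_bijective hG hn hPQ x.2 hx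
  have hfix : ∀ R : Sylow 7 G, y • R = R → R = P ∨ R = t • P := by
    intro R hR
    obtain ⟨i, rfl⟩ := hbij.2 R
    rcases i with _ | i
    · exact Or.inl rfl
    · right
      have h : y • sylowLabel P (t • P) x.1 (some i) = sylowLabel P (t • P) x.1 (some (2 * i)) :=
        smul_sylowLabel_some hx hyQ hyx i
      rw [h] at hR
      have hi : (2 * i : ZMod 7) = i := Option.some_injective _ (hbij.1 hR)
      have : i = 0 := by
        have : ∀ i : ZMod 7, 2 * i = i → i = 0 := by decide
        exact this i hi
      subst this
      simp [sylowLabel]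
  have horder : ∀ g : G, 3 ∣ orderOf g → orderOf g = 3 := fun g =>
    orderOf_eq_three_of_card_normalizer_le hG h3 hy3
      (card_normalizer_zpowers_le hPQ rfl htQ hyP hyQ hy3 hD hfix)
  refine ⟨P, t • P, x, y, t, hPQ, x.2, hx, hyP, hyQ, hyx, rfl, htt, htfix, ?_⟩
  have hmem : t * y * t ∈ Subgroup.zpowers y := hD _
    (by rw [mul_smul, mul_smul, hyQ, htQ]) (by rw [mul_smul, mul_smul, htQ, hyP])
  rw [mem_zpowers_iff_mem_range_orderOf, hy3] at hmem
  simp only [Finset.mem_image, Finset.mem_range] at hmem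
  obtain ⟨k, hk3, hk⟩ := hmem
  have hk' : t * y = y ^ k * t := by rw [hk, mul_assoc _ t t, htt, mul_one]
  -- The exponent 1 is impossible: `t` and `y` would commute and `t * y` would have order 6,
  -- contrary to `horder`.
  interval_cases k
  · rw [pow_zero, one_mul, mul_eq_left] at hk'
    rw [hk', orderOf_one] at hy3
    norm_num at hy3
  · rw [pow_one] at hk'
    have hc : Commute t y := hk'
    have ho := hc.orderOf_mul_eq_mul_orderOf_of_coprime (by rw [ht, hy3]; norm_num)
    have := horder (t * y) (by rw [ho, hy3]; exact dvd_mul_left _ _)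
    rw [ho, ht, hy3] at this
    norm_num at this
  · rw [hk', pow_two]

end order168

/-! ### Isomorphism with the model group. -/

theorem nonempty_mulEquiv_lineGroup_of_card {G : Type u} [Group G] [Finite G]
    (hG : Nat.card G = 168) (hn : Nat.card (Sylow 7 G) = 8)
    (h7 : singularCount G 7 = 48) (h3 : singularCount G 3 = 56) :
    Nonempty (G ≃* lineGroup) := by
  obtain ⟨P, Q, x, y, t, hPQ, hxP, hx, hyP, hyQ, hyx, htP, htt, htfix, hty⟩ :=
    exists_standard_generators hG hn h7 h3
  let e := Equiv.ofBijective _ (sylowLabel_bijective hG hn hPQ hxP hx)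
  let φ : G →* Equiv.Perm (Option (ZMod 7)) :=
    e.symm.permCongrHom.toMonoidHom.comp (MulAction.toPermHom G (Sylow 7 G))
  have hφ : ∀ g z, e (φ g z) = g • e z := fun g z => by
    simp [φ, Equiv.permCongrHom]
  have hφx : φ x = lineTranslation := by
    refine Equiv.ext fun z => e.injective ?_
    rw [hφ]
    rcases z with _ | i
    · exact Sylow.smul_eq_iff_mem_normalizer.2 (Subgroup.le_normalizer hxP)
    · change x • sylowLabel P Q x (some i) = sylowLabel P Q x (some (i + 1))
      have h : (i + 1 : ZMod 7) = ((i.val + 1 : ℕ) : ZMod 7) := by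
        rw [Nat.cast_add, ZMod.natCast_zmod_val, Nat.cast_one]
      rw [h, sylowLabel_natCast hx, pow_succ', mul_smul]
      rfl
  have hφy : φ y = lineHomothety := by
    refine Equiv.ext fun z => e.injective ?_
    rw [hφ]
    rcases z with _ | i
    · exact hyP
    · exact smul_sylowLabel_some (P := P) hx hyQ hyx i
  obtain ⟨k, hk⟩ := exists_homothety_pow_mul_eq_lineInversion (f := φ t)
    (e.injective (by
      rw [hφ]
      change t • P = x ^ (0 : ZMod 7).val • Q
      rw [ZMod.val_zero, pow_zero, one_smul, htP]))
    (fun z => by rw [← Equiv.Perm.mul_apply, ← map_mul, htt, map_one]; rfl)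
    (fun z hz => htfix (e z) (by rw [← hφ, hz]))
    (fun z => by
      rw [← hφy, ← Equiv.Perm.mul_apply, ← map_mul, hty, map_mul, map_mul]; rfl)
  have hφt : φ (y ^ k * t) = lineInversion := by
    rw [map_mul, map_pow, hφy]
    exact Equiv.ext hk
  have hle : lineGroup ≤ φ.range := by
    rw [lineGroup, Subgroup.closure_le]
    rintro _ (rfl | rfl | rfl)
    · exact ⟨x, hφx⟩
    · exact ⟨y, hφy⟩
    · exact ⟨_, hφt⟩
  -- Orders alone now give both the injectivity of `φ` and its image: `|φ(G)|` divides 168, which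
  -- divides `|lineGroup|`.
  have hrange : Nat.card φ.range ∣ 168 := hG ▸ Subgroup.card_range_dvd φ
  have hcard : Nat.card φ.range = Nat.card lineGroup :=
    Nat.dvd_antisymm (hrange.trans dvd_card_lineGroup) (Subgroup.card_dvd_of_le hle)
  have h168 : Nat.card φ.range = Nat.card G := by
    rw [hG]
    exact Nat.dvd_antisymm hrange (hcard ▸ dvd_card_lineGroup)
  have heq : lineGroup = φ.range := Subgroup.eq_of_le_of_card_ge hle hcard.le
  have hbij : Function.Bijective φ.rangeRestrict :=
    (Nat.bijective_iff_surjective_and_card _).2 ⟨φ.rangeRestrict_surjective, h168.symm⟩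
  exact ⟨(MulEquiv.ofBijective _ hbij).trans (MulEquiv.subgroupCongr heq.symm)⟩

theorem nonempty_mulEquiv_lineGroup {G : Type u} [Group G] [Finite G]
    (h : expRho G = {48, 56, 105}) : Nonempty (G ≃* lineGroup) := by
  obtain ⟨hG, h7, h3⟩ := card_and_singularCount_of_expRho h
  obtain ⟨hG, hn⟩ := card_and_card_sylow_seven hG h7 h3
  exact nonempty_mulEquiv_lineGroup_of_card hG hn h7 h3

/-! ### The value of `ρ(PSL(2,7))`. -/

theorem rho_congr {G : Type*} {H : Type*} [Group G] [Finite G] [Group H] [Finite H]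
    (e : G ≃* H) : rho G = rho H := by
  unfold rho
  exact finprod_eq_of_bijective e e.bijective fun g => (MulEquiv.orderOf_eq e g).symm

theorem expSet_of_eq : expSet (2 ^ 105 * 3 ^ 56 * 7 ^ 48) = {48, 56, 105} := by
  have h2 := Nat.prime_two
  have h3 := Nat.prime_three
  have h7 : Nat.Prime 7 := by norm_num
  have hf : ∀ p, (2 ^ 105 * 3 ^ 56 * 7 ^ 48).factorization p =
      105 * (Nat.factorization 2 p) + 56 * (Nat.factorization 3 p) +
        48 * (Nat.factorization 7 p) := fun p => by
    rw [Nat.factorization_mul (by positivity) (by positivity),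
      Nat.factorization_mul (by positivity) (by positivity), Nat.factorization_pow,
      Nat.factorization_pow, Nat.factorization_pow]
    rfl
  have f2 : (2 ^ 105 * 3 ^ 56 * 7 ^ 48).factorization 2 = 105 := by
    rw [hf, h2.factorization, h3.factorization, h7.factorization]; simp
  have f3 : (2 ^ 105 * 3 ^ 56 * 7 ^ 48).factorization 3 = 56 := by
    rw [hf, h2.factorization, h3.factorization, h7.factorization]; simp
  have f7 : (2 ^ 105 * 3 ^ 56 * 7 ^ 48).factorization 7 = 48 := by
    rw [hf, h2.factorization, h3.factorization, h7.factorization]; simp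
  ext a
  simp only [expSet, Set.mem_ofPred_eq, Set.mem_insert_iff, Set.mem_singleton_iff]
  constructor
  · rintro ⟨p, hp, hpd, rfl⟩
    rcases hp.dvd_mul.1 hpd with h | h
    · rcases hp.dvd_mul.1 h with h | h
      · rw [(Nat.prime_dvd_prime_iff_eq hp h2).1 (hp.dvd_of_dvd_pow h)]; omega
      · rw [(Nat.prime_dvd_prime_iff_eq hp h3).1 (hp.dvd_of_dvd_pow h)]; omega
    · rw [(Nat.prime_dvd_prime_iff_eq hp h7).1 (hp.dvd_of_dvd_pow h)]; omega
  · rintro (rfl | rfl | rfl)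
    · exact ⟨7, h7, Dvd.dvd.mul_left (dvd_pow_self _ (by norm_num)) _, f7⟩
    · exact ⟨3, h3, Dvd.dvd.mul_right (Dvd.dvd.mul_left (dvd_pow_self _ (by norm_num)) _) _, f3⟩
    · exact ⟨2, h2, Dvd.dvd.mul_right (Dvd.dvd.mul_right (dvd_pow_self _ (by norm_num)) _) _, f2⟩

/-- The polynomials `s` with `A ^ (n + 1) = s (n + 1) A - s n` for a `2 × 2` matrix `A` of
determinant `1` and trace `t`. -/
def chebyshevSeq (t : ZMod 7) : ℕ → ZMod 7
  | 0 => 0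
  | 1 => 1
  | n + 2 => t * chebyshevSeq t (n + 1) - chebyshevSeq t n

theorem pow_succ_eq_chebyshevSeq {A : Matrix (Fin 2) (Fin 2) (ZMod 7)} (hA : A.det = 1) (n : ℕ) :
    A ^ (n + 1) = chebyshevSeq A.trace (n + 1) • A - chebyshevSeq A.trace n • 1 := by
  have hsq : A * A = A.trace • A - 1 := by
    have h := Matrix.det_fin_two A
    rw [hA] at h
    ext i j
    fin_cases i <;> fin_cases j <;>
      simp [Matrix.mul_apply, Fin.sum_univ_two, Matrix.trace_fin_two] <;>
      first | ring1 | linear_combination h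
  induction n with
  | zero => simp [chebyshevSeq]
  | succ n ih =>
    rw [pow_succ, ih, sub_mul, smul_mul_assoc, smul_mul_assoc, hsq, one_mul]
    simp only [chebyshevSeq, smul_sub, smul_smul, sub_smul]
    rw [mul_comm A.trace]
    abel

/-- The order in `PSL(2, 7)` of a non-scalar matrix of trace `t` and determinant `1`. -/
def orderOfTrace (t : ZMod 7) : ℕ :=
  if t = 0 then 2 else if t ^ 2 = 1 then 3 else if t ^ 2 = 2 then 4 else 7

/-- The order in `PSL(2, 7)` of a matrix of determinant `1` with entries `a`, `b`, `c`, `d`. -/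
def orderOfEntries (a b c d : ZMod 7) : ℕ :=
  if b = 0 ∧ c = 0 ∧ a = d then 1 else orderOfTrace (a + d)

open Matrix in
theorem mem_center_iff_entries (A : SpecialLinearGroup (Fin 2) (ZMod 7)) :
    A ∈ Subgroup.center (SpecialLinearGroup (Fin 2) (ZMod 7)) ↔
      A 0 1 = 0 ∧ A 1 0 = 0 ∧ A 0 0 = A 1 1 := by
  rw [Matrix.SpecialLinearGroup.mem_center_iff]
  constructor
  · rintro ⟨r, -, h⟩
    rw [← h]
    simp
  · rintro ⟨h1, h2, h3⟩
    refine ⟨A 0 0, ?_, ?_⟩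
    · have := A.det_coe
      rw [det_fin_two, h1, h2, ← h3] at this
      simpa [pow_two] using this
    · ext i j
      fin_cases i <;> fin_cases j <;> simp [h1, h2, h3]

-- For non-scalar `A`, the recursion from Cayley–Hamilton makes `A ^ n` scalar exactly when
-- `chebyshevSeq` of the trace vanishes at `n`, so the order is read off from the trace.
open Matrix in
theorem orderOf_mk_eq_orderOfEntries (A : SpecialLinearGroup (Fin 2) (ZMod 7)) :
    orderOf (QuotientGroup.mk A : PSL27) =
      orderOfEntries (A 0 0) (A 0 1) (A 1 0) (A 1 1) := by
  by_cases hA : A ∈ Subgroup.center (SpecialLinearGroup (Fin 2) (ZMod 7))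
  · rw [(QuotientGroup.eq_one_iff A).2 hA, orderOf_one, orderOfEntries,
      if_pos ((mem_center_iff_entries A).1 hA)]
  have hpow : ∀ n : ℕ, (QuotientGroup.mk A : PSL27) ^ (n + 1) = 1 ↔
      chebyshevSeq (A : Matrix (Fin 2) (Fin 2) (ZMod 7)).trace (n + 1) = 0 := by
    intro n
    rw [← QuotientGroup.mk_pow, QuotientGroup.eq_one_iff, mem_center_iff_entries]
    rw [mem_center_iff_entries] at hA
    rw [Matrix.SpecialLinearGroup.coe_pow, pow_succ_eq_chebyshevSeq A.det_coe]
    simp only [Matrix.sub_apply, Matrix.smul_apply, smul_eq_mul, one_apply_eq, sub_left_inj]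
    rw [one_apply_ne (by decide), one_apply_ne (by decide), mul_zero, sub_zero, sub_zero]
    constructor
    · rintro ⟨h1, h2, h3⟩
      by_contra h
      exact hA ⟨(mul_eq_zero.1 h1).resolve_left h, (mul_eq_zero.1 h2).resolve_left h,
        mul_left_cancel₀ h h3⟩
    · intro h
      simp [h]
  rw [orderOfEntries, if_neg (by rwa [← mem_center_iff_entries]), ← trace_fin_two]
  generalize (A : Matrix (Fin 2) (Fin 2) (ZMod 7)).trace = t at hpow
  have key : ∀ t : ZMod 7, 0 < orderOfTrace t ∧
      chebyshevSeq t (orderOfTrace t - 1 + 1) = 0 ∧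
      ∀ m < orderOfTrace t, 0 < m → chebyshevSeq t (m - 1 + 1) ≠ 0 := by decide +kernel
  obtain ⟨h0, h1, h2⟩ := key t
  rw [orderOf_eq_iff h0]
  refine ⟨?_, fun m hm hm0 => ?_⟩
  · rw [← Nat.sub_add_cancel h0, hpow]; exact h1
  · rw [← Nat.sub_add_cancel hm0, Ne, hpow]; exact h2 m hm hm0

theorem prod_orderOfEntries : (∏ a : ZMod 7, ∏ b : ZMod 7, ∏ c : ZMod 7, ∏ d : ZMod 7,
    if a * d - b * c = 1 then orderOfEntries a b c d else 1) =
      (2 ^ 105 * 3 ^ 56 * 7 ^ 48) ^ 2 := by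
  decide +kernel

open Matrix in
theorem card_center_sl : Nat.card (Subgroup.center (SpecialLinearGroup (Fin 2) (ZMod 7))) = 2 := by
  have h : ((Subgroup.center (SpecialLinearGroup (Fin 2) (ZMod 7)) :
      Subgroup (SpecialLinearGroup (Fin 2) (ZMod 7))) :
        Set (SpecialLinearGroup (Fin 2) (ZMod 7))) = {1, -1} := by
    ext A
    rw [SetLike.mem_coe, mem_center_iff_entries]
    constructor
    · rintro ⟨h1, h2, h3⟩
      have := A.det_coe
      rw [det_fin_two, h1, h2, ← h3, mul_zero, sub_zero, mul_self_eq_one_iff] at this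
      refine this.imp (fun h => ?_) fun h => ?_ <;>
      · ext i j
        fin_cases i <;> fin_cases j <;> simp [h1, h2, ← h3, h]
    · rintro (rfl | rfl) <;> simp
  refine (congrArg Set.ncard h).trans (Set.ncard_pair ?_)
  intro h
  have := congrArg (fun A : SpecialLinearGroup (Fin 2) (ZMod 7) => A 0 0) h
  simp at this
  revert this
  decide

-- The product is taken over `SL(2,7)`, where each element of the quotient has two lifts; hence the
-- square.
open Matrix in
theorem rho_psl27 : rho PSL27 = 2 ^ 105 * 3 ^ 56 * 7 ^ 48 := by
  classical
  have := Fintype.ofFinite PSL27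
  have := Fintype.ofFinite (SpecialLinearGroup (Fin 2) (ZMod 7))
  refine Nat.pow_left_injective (n := 2) (by norm_num) ?_
  change rho PSL27 ^ 2 = (2 ^ 105 * 3 ^ 56 * 7 ^ 48) ^ 2
  have h1 : rho PSL27 ^ 2 = ∏ A : SpecialLinearGroup (Fin 2) (ZMod 7),
      orderOf (QuotientGroup.mk A : PSL27) := by
    rw [rho_eq_prod, ← Finset.prod_pow,
      ← Finset.prod_fiberwise (s := Finset.univ)
        (g := fun A : SpecialLinearGroup (Fin 2) (ZMod 7) => (QuotientGroup.mk A : PSL27))]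
    refine Finset.prod_congr rfl fun q _ => ?_
    rw [Finset.prod_congr rfl (g := fun _ => orderOf q) (by
      intro A hA; rw [(Finset.mem_filter.1 hA).2]), Finset.prod_const]
    congr 1
    have h := QuotientGroup.card_preimage_mk
      (Subgroup.center (SpecialLinearGroup (Fin 2) (ZMod 7))) {q}
    rw [card_center_sl, show Nat.card ({q} : Set PSL27) = 1 from Nat.card_unique, mul_one] at h
    refine h.symm.trans ?_
    rw [← Fintype.card_subtype, ← Nat.card_eq_fintype_card]
    rfl
  rw [h1, ← prod_orderOfEntries]
  trans ∏ p : ZMod 7 × ZMod 7 × ZMod 7 × ZMod 7 with p.1 * p.2.2.2 - p.2.1 * p.2.2.1 = 1,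
      orderOfEntries p.1 p.2.1 p.2.2.1 p.2.2.2
  · refine Finset.prod_bij (fun A _ => (A 0 0, A 0 1, A 1 0, A 1 1)) (fun A _ => ?_)
      (fun A _ B _ h => ?_) (fun p hp => ?_) fun A _ => orderOf_mk_eq_orderOfEntries A
    · have := A.det_coe
      rw [det_fin_two] at this
      simpa using this
    · simp only [Prod.mk.injEq] at h
      ext i j
      fin_cases i <;> fin_cases j <;> simp [h]
    · rw [Finset.mem_filter] at hp
      refine ⟨⟨!![p.1, p.2.1; p.2.2.1, p.2.2.2], ?_⟩, Finset.mem_univ _, ?_⟩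
      · rw [det_fin_two_of]; exact hp.2
      · simp
  · rw [Finset.prod_filter]
    simp only [Fintype.prod_prod_type]

theorem mainTheorem3 :
    expRho PSL27 = {48, 56, 105} ∧
      ∀ (G : Type*) [Group G] [Finite G],
        Nonempty (G ≃* PSL27) ↔ expRho G = expRho PSL27 := by
  have h : expRho PSL27 = {48, 56, 105} := by rw [expRho, rho_psl27, expSet_of_eq]
  refine ⟨h, fun G _ _ => ⟨fun ⟨e⟩ => by rw [expRho, expRho, rho_congr e], fun hG => ?_⟩⟩
  -- The uniqueness result is applied to `G` and to `PSL27` alike, so no explicit isomorphism of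
  -- `PSL27` with `lineGroup` is required.
  obtain ⟨e₁⟩ := nonempty_mulEquiv_lineGroup (hG.trans h)
  obtain ⟨e₂⟩ := nonempty_mulEquiv_lineGroup h
  exact ⟨e₁.trans e₂.symm⟩
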